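/- A finite quadratic form is a finite abelian group $A$ with a map $q\colon A\to\mathbb{Q}/2\mathbb{Z}$ such that $q(na)=n^2q(a)$ for all $n\in\mathbb{Z}$, $a\in A$, and $q(x+y)-q(x)-q(y)=2b(x,y)$ for a symmetric bilinear form $b\colon A\times A\to\mathbb{Q}/\mathbb{Z}$ (here multiplication by $2$ is the isomorphism $\mathbb{Q}/\mathbb{Z}\cong\mathbb{Q}/2\mathbb{Z}$, so $b$ is determined by $q$). It is nondegenerate if only $0$ is $b$-orthogonal to all of $A$. Isometries are group isomorphisms preserving $q$, embeddings are injective group homomorphisms preserving $q$, and orthogonal complements are taken with respect to $b$ and carry the restriction of $q$. Let $u(2)$ and $v(2)$ be the finite quadratic forms on $(\mathbb{Z}/2\mathbb{Z})^2$ with Gram matrices $$u(2)=\begin{pmatrix}0&1/2\\1/2&0\end{pmatrix},\qquad v(2)=\begin{pmatrix}1&1/2\\1/2&1\end{pmatrix},$$ with diagonal entries (values of $q$) in $\mathbb{Q}/2\mathbb{Z}$ and off-diagonal entries (values of $b$) in $\mathbb{Q}/\mathbb{Z}$. **Lemma.** Let $A$ be a nondegenerate finite quadratic form, and let $Q$ be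 a finite quadratic form isometric to an orthogonal direct sum $u(2)^{\oplus m}\oplus v(2)^{\oplus n}$ with $m,n\ge 0$. If $f,g\colon Q\hookrightarrow A$ are any two embeddings, then the orthogonal complements $f(Q)^\perp$ and $g(Q)^\perp$ in $A$ are isometric. That is, $Q^\perp\subset A$ is determined up to isometry by $A$ and $Q$, independently of the chosen embedding. -/

import Mathlib

noncomputable section

namespace FinQuad

/-- The group `ℚ/ℤ`. -/
abbrev QModZ : Type := ℚ ⧸ AddSubgroup.zmultiples (1 : ℚ)

/-- The group `ℚ/2ℤ`. -/
abbrev QMod2Z : Type := ℚ ⧸ AddSubgroup.zmultiples (2 : ℚ)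

/-- The isomorphism `ℚ/ℤ ≅ ℚ/2ℤ` given by `r ↦ 2 r`. -/
def doubling : QModZ ≃ₗ[ℤ] QMod2Z :=
  (QuotientAddGroup.congr (AddSubgroup.zmultiples (1 : ℚ)) (AddSubgroup.zmultiples (2 : ℚ))
    (DistribMulAction.toAddEquiv₀ ℚ (2 : ℚ) two_ne_zero)
    (by
      rw [AddMonoidHom.map_zmultiples]
      exact congrArg AddSubgroup.zmultiples (mul_one (2 : ℚ)))).toIntLinearEquiv

theorem doubling_mk (r : ℚ) : doubling (r : QModZ) = ((2 * r : ℚ) : QMod2Z) := rfl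

/-- A quadratic form on an abelian group `A`: a map `q : A → ℚ/2ℤ` with `q (n a) = n² q (a)` for
`n : ℤ`, such that `q (x + y) - q x - q y` is bilinear. It is called a finite quadratic form when
`A` is finite. -/
abbrev Form (A : Type*) [AddCommGroup A] : Type _ := QuadraticMap ℤ A QMod2Z

section

variable {A : Type*} [AddCommGroup A]

/-- The symmetric bilinear form `b : A × A → ℚ/ℤ` of a quadratic form `q : A → ℚ/2ℤ`,
determined by `q (x + y) - q x - q y = 2 b (x, y)` in `ℚ/2ℤ`. -/
def bilin (q : Form A) : LinearMap.BilinMap ℤ A QModZ :=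
  q.polarBilin.compr₂ doubling.symm.toLinearMap

theorem doubling_bilin (q : Form A) (x y : A) :
    doubling (bilin q x y) = q (x + y) - q x - q y := by
  simp [bilin, QuadraticMap.polar]

/-- Nondegeneracy: only `0` is orthogonal to all of `A`. -/
def Nondegenerate (q : Form A) : Prop := (bilin q).Nondegenerate

/-- The orthogonal complement of a subgroup with respect to `b`. -/
def perp (q : Form A) (S : Submodule ℤ A) : Submodule ℤ A := S.orthogonalBilin (bilin q)

end

/-- The homomorphism `ℤ/2ℤ → ℚ/2ℤ` that sends the class of the integer `n` to the class of `n`. -/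
def ofZMod2 : ZMod 2 →ₗ[ℤ] QMod2Z :=
  (ZMod.lift 2 ⟨(QuotientAddGroup.mk' (AddSubgroup.zmultiples (2 : ℚ))).comp
    (Int.castAddHom ℚ), by
      simp only [AddMonoidHom.comp_apply]
      exact (QuotientAddGroup.eq_zero_iff _).2 (by simp)⟩).toIntLinearMap

theorem ofZMod2_intCast (n : ℤ) : ofZMod2 (n : ZMod 2) = ((n : ℚ) : QMod2Z) := by
  simp [ofZMod2]

/-- `u(2)`: the group `(ℤ/2ℤ)²` with `q (x, y) = x y mod 2`. -/
def uTwo : Form (ZMod 2 × ZMod 2) :=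
  ofZMod2.compQuadraticMap'
    (QuadraticMap.linMulLin (LinearMap.fst (ZMod 2) (ZMod 2) (ZMod 2))
      (LinearMap.snd (ZMod 2) (ZMod 2) (ZMod 2)))

/-- `v(2)`: the group `(ℤ/2ℤ)²` with `q (x, y) = x² + x y + y² mod 2`. -/
def vTwo : Form (ZMod 2 × ZMod 2) :=
  ofZMod2.compQuadraticMap'
    (QuadraticMap.linMulLin (LinearMap.fst (ZMod 2) (ZMod 2) (ZMod 2))
        (LinearMap.fst (ZMod 2) (ZMod 2) (ZMod 2))
      + QuadraticMap.linMulLin (LinearMap.fst (ZMod 2) (ZMod 2) (ZMod 2))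
        (LinearMap.snd (ZMod 2) (ZMod 2) (ZMod 2))
      + QuadraticMap.linMulLin (LinearMap.snd (ZMod 2) (ZMod 2) (ZMod 2))
        (LinearMap.snd (ZMod 2) (ZMod 2) (ZMod 2)))

theorem uTwo_apply (x y : ZMod 2) : uTwo (x, y) = ofZMod2 (x * y) := rfl

theorem vTwo_apply (x y : ZMod 2) : vTwo (x, y) = ofZMod2 (x * x + x * y + y * y) := rfl

/-- The Gram matrix of `u(2)` is `(0, 1/2; 1/2, 0)`. -/
theorem uTwo_gram : uTwo (1, 0) = 0 ∧ uTwo (0, 1) = 0 ∧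
    bilin uTwo (1, 0) (0, 1) = ((1 / 2 : ℚ) : QModZ) := by
  have h1 : ofZMod2 1 = ((1 : ℚ) : QMod2Z) := by simpa using ofZMod2_intCast 1
  refine ⟨by simp [uTwo_apply], by simp [uTwo_apply], doubling.injective ?_⟩
  rw [doubling_bilin, doubling_mk]
  simp [uTwo_apply, h1]

/-- The Gram matrix of `v(2)` is `(1, 1/2; 1/2, 1)`. -/
theorem vTwo_gram : vTwo (1, 0) = ((1 : ℚ) : QMod2Z) ∧ vTwo (0, 1) = ((1 : ℚ) : QMod2Z) ∧
    bilin vTwo (1, 0) (0, 1) = ((1 / 2 : ℚ) : QModZ) := by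
  have h1 : ofZMod2 1 = ((1 : ℚ) : QMod2Z) := by simpa using ofZMod2_intCast 1
  refine ⟨by simp [vTwo_apply, h1], by simp [vTwo_apply, h1], doubling.injective ?_⟩
  rw [doubling_bilin, doubling_mk]
  have h3 : (1 + 1 + 1 : ZMod 2) = 1 := by decide
  have h2 : ofZMod2 1 + ofZMod2 1 = 0 := by
    rw [← map_add, show (1 + 1 : ZMod 2) = 0 by decide, map_zero]
  have h4 : -ofZMod2 1 = ofZMod2 1 := neg_eq_of_add_eq_zero_left h2
  simp [vTwo_apply, h3, ← h1, sub_eq_add_neg, h4]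

/-- The orthogonal direct sum `u(2)^m ⊕ v(2)^n`. -/
def sumUV (m n : ℕ) : Form ((Fin m → ZMod 2 × ZMod 2) × (Fin n → ZMod 2 × ZMod 2)) :=
  (QuadraticMap.pi fun _ : Fin m => uTwo).prod (QuadraticMap.pi fun _ : Fin n => vTwo)

end FinQuad

end

/-! This is a Witt-type extension argument: any two isometric maps `f`, `g` from `Q` to `A` differ
by an isometry of `A`, which then carries one orthogonal complement onto the other
(`equivalent_restrict_perp_range`). Each summand u(2) or v(2) is generated by two elements killed by
2, with integral values of `q` and pairing 1/2. That is all the argument uses, so both types are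
treated alike. For such r the map z ↦ z + 2b(z, r)r makes sense. It is an isometry when q(r) = 1,
and suitable composites of such maps are isometries when isotropic vectors occur. These isometries
move one pair to another while fixing what is orthogonal to both (`exists_isometry_map_pair_eq`), so
the summands can be matched one at a time (`IsPairBasis.exists_isometry_comp_eq`). -/

namespace FinQuad

/-! ### Transvections along 2-torsion elements with integral values -/

section Transvection

variable {A : Type*} [AddCommGroup A] {q : Form A}

/-- The class of `1` in `ℚ/2ℤ`, the only element of order two. -/
def one : QMod2Z := ((1 : ℚ) : QMod2Z)

theorem one_ne_zero : one ≠ 0 := by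
  intro h
  obtain ⟨k, hk⟩ := AddSubgroup.mem_zmultiples_iff.1 ((QuotientAddGroup.eq_zero_iff _).1 h)
  rw [zsmul_eq_mul] at hk
  have h2 : k * 2 = 1 := by exact_mod_cast hk
  omega

theorem one_add_one : one + one = 0 := by
  rw [one, ← QuotientAddGroup.mk_add, QuotientAddGroup.eq_zero_iff]
  exact AddSubgroup.mem_zmultiples_iff.2 ⟨1, by norm_num⟩

theorem eq_zero_or_one_of_add_self {t : QMod2Z} (h : t + t = 0) :
    t = 0 ∨ t = one := by
  obtain ⟨r, rfl⟩ := QuotientAddGroup.mk_surjective t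
  rw [← QuotientAddGroup.mk_add, QuotientAddGroup.eq_zero_iff] at h
  obtain ⟨k, hk⟩ := AddSubgroup.mem_zmultiples_iff.1 h
  have hr : r = k := by
    rw [zsmul_eq_mul] at hk
    linarith
  subst hr
  rcases Int.even_or_odd' k with ⟨m, rfl | rfl⟩
  · left
    rw [QuotientAddGroup.eq_zero_iff]
    exact AddSubgroup.mem_zmultiples_iff.2 ⟨m, by push_cast; rw [zsmul_eq_mul]; ring⟩
  · right
    rw [one, QuotientAddGroup.eq]
    exact AddSubgroup.mem_zmultiples_iff.2 ⟨-m, by push_cast; rw [zsmul_eq_mul]; push_cast; ring⟩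

/-- The elements of order at most two on which the form takes an integral value. -/
def IsEvenTwoTorsion (q : Form A) (r : A) : Prop := r + r = 0 ∧ (q r = 0 ∨ q r = one)

theorem map_add_polar (q : Form A) (x y : A) :
    q (x + y) = q x + q y + QuadraticMap.polar q x y := by
  simp [QuadraticMap.polar]

/-- By bilinearity, twice the pairing with r is the pairing with r + r = 0. Hence the coefficient of
r in a transvection is just a choice between 0 and 1. -/
theorem polar_eq_zero_or_one {r : A} (hr : r + r = 0) (z : A) :
    QuadraticMap.polar q z r = 0 ∨ QuadraticMap.polar q z r = one :=
  eq_zero_or_one_of_add_self (by rw [← QuadraticMap.polar_add_right, hr,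
    QuadraticMap.polar_zero_right])

/-- Here integrality matters: the value is q(2r) - 2q(r), and 2q(r) vanishes in ℚ/2ℤ only if q(r) is
integral. -/
theorem IsEvenTwoTorsion.polar_self {r : A} (hr : IsEvenTwoTorsion q r) :
    QuadraticMap.polar q r r = 0 := by
  rw [QuadraticMap.polar, hr.1, QuadraticMap.map_zero]
  rcases hr.2 with h | h <;> rw [h]
  · simp
  · rw [zero_sub, ← neg_add', one_add_one, neg_zero]

theorem IsEvenTwoTorsion.add {r s : A} (hr : IsEvenTwoTorsion q r) (hs : IsEvenTwoTorsion q s) :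
    IsEvenTwoTorsion q (r + s) := by
  refine ⟨by rw [add_add_add_comm, hr.1, hs.1, add_zero], ?_⟩
  rw [map_add_polar]
  rcases hr.2 with h | h <;> rcases hs.2 with h' | h' <;>
    rcases polar_eq_zero_or_one (q := q) hs.1 r with h'' | h'' <;>
    simp [h, h', h'', one_add_one]

theorem IsEvenTwoTorsion.map {B : Type*} [AddCommGroup B] {p : Form B} {r : B}
    (hr : IsEvenTwoTorsion p r) (f : p →qᵢ q) : IsEvenTwoTorsion q (f r) :=
  ⟨by rw [← map_add, hr.1, map_zero], by simpa using hr.2⟩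

theorem polar_map {B : Type*} [AddCommGroup B] {p : Form B} (f : p →qᵢ q) (x y : B) :
    QuadraticMap.polar q (f x) (f y) = QuadraticMap.polar p x y := by
  simp only [QuadraticMap.polar, ← map_add, QuadraticMap.Isometry.map_app]

open Classical in
/-- The transvection `z ↦ z + 2 b(z, r) r` along an element `r` of order two. -/
noncomputable def transvection (q : Form A) (r : A) (hr : r + r = 0) : A →ₗ[ℤ] A :=
  AddMonoidHom.toIntLinearMap
    (AddMonoidHom.mk' (fun z => if QuadraticMap.polar q z r = 0 then z else z + r) (by
      intro x y
      rw [QuadraticMap.polar_add_left]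
      rcases polar_eq_zero_or_one (q := q) hr x with hx | hx <;>
        rcases polar_eq_zero_or_one (q := q) hr y with hy | hy <;>
        simp only [hx, hy, add_zero, zero_add, one_add_one, one_ne_zero, if_true, if_false]
      · abel
      · abel
      · rw [add_add_add_comm, hr, add_zero]))

theorem transvection_of_zero {r : A} (hr : r + r = 0) {z : A}
    (h : QuadraticMap.polar q z r = 0) : transvection q r hr z = z :=
  if_pos h

theorem transvection_of_one {r : A} (hr : r + r = 0) {z : A}
    (h : QuadraticMap.polar q z r = one) : transvection q r hr z = z + r :=
  if_neg (h ▸ one_ne_zero)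

theorem polar_transvection {r : A} (hr : r + r = 0) {w : A}
    (h : QuadraticMap.polar q r w = 0) (z : A) :
    QuadraticMap.polar q (transvection q r hr z) w = QuadraticMap.polar q z w := by
  rcases polar_eq_zero_or_one (q := q) hr z with hz | hz
  · rw [transvection_of_zero hr hz]
  · rw [transvection_of_one hr hz, QuadraticMap.polar_add_left, h, add_zero]

theorem map_transvection_of_one {r : A} (hr : r + r = 0) (h : q r = one) (z : A) :
    q (transvection q r hr z) = q z := by
  rcases polar_eq_zero_or_one (q := q) hr z with hz | hz
  · rw [transvection_of_zero hr hz]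
  · rw [transvection_of_one hr hz, map_add_polar, hz, h, add_assoc, one_add_one, add_zero]

/-- Along an isotropic r the transvection fails to preserve q, but the defect is additive in r, so
it can cancel in a composite. -/
theorem map_transvection_of_zero {r : A} (hr : r + r = 0) (h : q r = 0) (z : A) :
    q (transvection q r hr z) = q z + QuadraticMap.polar q z r := by
  rcases polar_eq_zero_or_one (q := q) hr z with hz | hz
  · rw [transvection_of_zero hr hz, hz, add_zero]
  · rw [transvection_of_one hr hz, map_add_polar, h, add_zero]

theorem IsEvenTwoTorsion.transvection_involutive {r : A} (hr : IsEvenTwoTorsion q r) :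
    Function.Involutive (transvection q r hr.1) := by
  intro z
  rcases polar_eq_zero_or_one (q := q) hr.1 z with hz | hz
  · rw [transvection_of_zero hr.1 hz, transvection_of_zero hr.1 hz]
  · rw [transvection_of_one hr.1 hz, transvection_of_one hr.1, add_assoc, hr.1, add_zero]
    rw [QuadraticMap.polar_add_left, hz, hr.polar_self, add_zero]

/-- The transvection along an element of order two, as a linear automorphism. -/
noncomputable def transvectionEquiv (q : Form A) (r : A) (hr : IsEvenTwoTorsion q r) : A ≃ₗ[ℤ] A :=
  LinearEquiv.ofInvolutive (transvection q r hr.1) hr.transvection_involutive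

theorem transvectionEquiv_apply {r : A} (hr : IsEvenTwoTorsion q r) (z : A) :
    transvectionEquiv q r hr z = transvection q r hr.1 z := rfl

/-- Eichler transformations: an isotropic `d` and `u` orthogonal to it give an isometry that acts
on the complement of `d` as `z ↦ z + 2 b(z, u) d`. -/
theorem exists_eichler {d u : A} (hd : IsEvenTwoTorsion q d) (hu : IsEvenTwoTorsion q u)
    (hd0 : q d = 0) (hdu : QuadraticMap.polar q d u = 0) :
    ∃ σ : q.IsometryEquiv q, ∀ z, QuadraticMap.polar q z d = 0 →
      (QuadraticMap.polar q z u = 0 → σ z = z) ∧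
      (QuadraticMap.polar q z u = one → σ z = z + d) := by
  have hud : QuadraticMap.polar q u d = 0 := by rw [QuadraticMap.polar_comm, hdu]
  have hdd := hd.polar_self
  have huu := hu.polar_self
  have hs := hu.add hd
  rcases hu.2 with hu0 | hu1
  -- Now d, u and u + d are all isotropic. Composing their three transvections, the defects 2b(z, u
  -- + d), 2b(z, u) and 2b(z, d) add up to 0.
  · have hs0 : q (u + d) = 0 := by rw [map_add_polar, hu0, hd0, hud, add_zero, add_zero]
    refine ⟨⟨(transvectionEquiv q _ hs).trans
      ((transvectionEquiv q u hu).trans (transvectionEquiv q d hd)), fun z => ?_⟩, fun z hz =>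
      ⟨fun h => ?_, fun h => ?_⟩⟩
    · change q (transvection q d hd.1 (transvection q u hu.1 (transvection q _ hs.1 z))) = q z
      rw [map_transvection_of_zero _ hd0, map_transvection_of_zero _ hu0,
        map_transvection_of_zero _ hs0, polar_transvection _ hud, polar_transvection,
        polar_transvection, QuadraticMap.polar_add_right]
      · rcases polar_eq_zero_or_one (q := q) hu.1 z with h | h <;>
          rcases polar_eq_zero_or_one (q := q) hd.1 z with h' | h' <;>
          simp [h, h', one_add_one, add_assoc]
      · rw [QuadraticMap.polar_add_left, hud, hdd, add_zero]
      · rw [QuadraticMap.polar_add_left, huu, hdu, add_zero]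
    · change transvection q d hd.1 (transvection q u hu.1 (transvection q _ hs.1 z)) = z
      rw [transvection_of_zero hs.1 (by rw [QuadraticMap.polar_add_right, h, hz, add_zero]),
        transvection_of_zero hu.1 h, transvection_of_zero hd.1 hz]
    · change transvection q d hd.1 (transvection q u hu.1 (transvection q _ hs.1 z)) = z + d
      rw [transvection_of_one hs.1 (by rw [QuadraticMap.polar_add_right, h, hz, add_zero]),
        transvection_of_one hu.1 (by simp [QuadraticMap.polar_add_left, h, huu, hdu]),
        transvection_of_zero hd.1 (by simp [QuadraticMap.polar_add_left, hz, hdd, hud]),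
        show z + (u + d) + u = z + d + (u + u) by abel, hu.1, add_zero]
  -- Now u and u + d both have value 1, so two reflections suffice: the shifts by u and u + d
  -- combine to a shift by d.
  · have hs1 : q (u + d) = one := by rw [map_add_polar, hu1, hd0, hud, add_zero, add_zero]
    refine ⟨⟨(transvectionEquiv q u hu).trans (transvectionEquiv q _ hs), fun z => ?_⟩,
      fun z hz => ⟨fun h => ?_, fun h => ?_⟩⟩
    · change q (transvection q _ hs.1 (transvection q u hu.1 z)) = q z
      rw [map_transvection_of_one _ hs1, map_transvection_of_one _ hu1]
    · change transvection q _ hs.1 (transvection q u hu.1 z) = z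
      rw [transvection_of_zero hu.1 h,
        transvection_of_zero hs.1 (by rw [QuadraticMap.polar_add_right, h, hz, add_zero])]
    · change transvection q _ hs.1 (transvection q u hu.1 z) = z + d
      rw [transvection_of_one hu.1 h, transvection_of_one hs.1 (by
          simp [QuadraticMap.polar_add_left, QuadraticMap.polar_add_right, h, hz, huu, hud]),
        show z + u + (u + d) = z + d + (u + u) by abel, hu.1, add_zero]

/-- Reflections: an element `r` of order two with `q r = 1` gives the isometry
`z ↦ z + 2 b(z, r) r`. -/
theorem exists_reflection {r : A} (hr : IsEvenTwoTorsion q r) (h1 : q r = one) :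
    ∃ σ : q.IsometryEquiv q, ∀ z,
      (QuadraticMap.polar q z r = 0 → σ z = z) ∧ (QuadraticMap.polar q z r = one → σ z = z + r) :=
  ⟨⟨transvectionEquiv q r hr, map_transvection_of_one hr.1 h1⟩, fun _ =>
    ⟨transvection_of_zero hr.1, transvection_of_one hr.1⟩⟩

/-- If `x`, `x'` have the same integral value and `u` pairs nontrivially with both, some isometry
maps `x` to `x'` and fixes the complement of `x`, `x'`, `u`. -/
theorem exists_isometry_map_eq {x x' u : A} (hx : IsEvenTwoTorsion q x)
    (hx' : IsEvenTwoTorsion q x') (hu : IsEvenTwoTorsion q u) (h : q x = q x')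
    (hxu : QuadraticMap.polar q x u = one) (hxu' : QuadraticMap.polar q x' u = one) :
    ∃ σ : q.IsometryEquiv q, σ x = x' ∧ ∀ w, QuadraticMap.polar q w (x + x') = 0 →
      QuadraticMap.polar q w u = 0 → σ w = w := by
  have hd := hx.add hx'
  have hqq : q x' + q x' = 0 := by
    rcases hx'.2 with h | h <;> simp [h, one_add_one]
  have hxd : x + (x + x') = x' := by rw [← add_assoc, hx.1, zero_add]
  -- Since q(x) = q(x'), the value of q at d = x + x' is 2b(x, x'). If it is 0, the Eichler
  -- transformation of d and u sends x to x + d = x'; if it is 1, reflection in d does.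
  rcases polar_eq_zero_or_one (q := q) hx'.1 x with h0 | h1
  · obtain ⟨σ, hσ⟩ := exists_eichler hd hu (by rw [map_add_polar, h0, h, hqq, add_zero])
      (by rw [QuadraticMap.polar_add_left, hxu, hxu', one_add_one])
    refine ⟨σ, ?_, fun w hw hwu => (hσ w hw).1 hwu⟩
    rw [(hσ x (by rw [QuadraticMap.polar_add_right, hx.polar_self, h0, add_zero])).2 hxu, hxd]
  · obtain ⟨σ, hσ⟩ := exists_reflection hd (by rw [map_add_polar, h1, h, hqq, zero_add])
    refine ⟨σ, ?_, fun w hw _ => (hσ w).1 hw⟩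
    rw [(hσ x).2 (by rw [QuadraticMap.polar_add_right, hx.polar_self, h1, zero_add]), hxd]

/-- Isometries act transitively on the pairs of order two elements with given integral values and
nontrivial pairing, fixing the common orthogonal complement. -/
theorem exists_isometry_map_pair_eq {x y x' y' : A} (hx : IsEvenTwoTorsion q x)
    (hy : IsEvenTwoTorsion q y) (hx' : IsEvenTwoTorsion q x') (hy' : IsEvenTwoTorsion q y')
    (hqx : q x = q x') (hqy : q y = q y')
    (h : QuadraticMap.polar q x y = one) (h' : QuadraticMap.polar q x' y' = one) :
    ∃ σ : q.IsometryEquiv q, σ x = x' ∧ σ y = y' ∧ ∀ w, QuadraticMap.polar q w x = 0 →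
      QuadraticMap.polar q w y = 0 → QuadraticMap.polar q w x' = 0 →
      QuadraticMap.polar q w y' = 0 → σ w = w := by
  -- One of y, y', y + y' pairs nontrivially with both x and x': the sum works when y is orthogonal
  -- to x' and y' to x.
  obtain ⟨u, hu, hxu, hxu', huw⟩ : ∃ u, IsEvenTwoTorsion q u ∧ QuadraticMap.polar q x u = one ∧
      QuadraticMap.polar q x' u = one ∧ ∀ w, QuadraticMap.polar q w y = 0 →
      QuadraticMap.polar q w y' = 0 → QuadraticMap.polar q w u = 0 := by
    rcases polar_eq_zero_or_one (q := q) hy.1 x' with h1 | h1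
    · rcases polar_eq_zero_or_one (q := q) hy'.1 x with h2 | h2
      · refine ⟨y + y', hy.add hy', ?_, ?_, fun w hw hw' => ?_⟩ <;>
          simp [QuadraticMap.polar_add_right, *]
      · exact ⟨y', hy', h2, h', fun w _ hw => hw⟩
    · exact ⟨y, hy, h, h1, fun w hw _ => hw⟩
  obtain ⟨σ, hσx, hσ⟩ := exists_isometry_map_eq hx hx' hu hqx hxu hxu'
  have hσy : IsEvenTwoTorsion q (σ y) := hy.map σ.toIsometry
  have hσp : ∀ a b, QuadraticMap.polar q (σ a) (σ b) = QuadraticMap.polar q a b :=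
    polar_map σ.toIsometry
  have hyx : QuadraticMap.polar q (σ y) x' = one := by
    rw [← hσx, hσp, QuadraticMap.polar_comm, h]
  have hyx' : QuadraticMap.polar q y' x' = one := by rw [QuadraticMap.polar_comm, h']
  -- Using x' as the auxiliary vector keeps it fixed: it is orthogonal to itself, and it pairs to 1
  -- with both σ y and y', hence to 0 with their sum.
  obtain ⟨τ, hτy, hτ⟩ := exists_isometry_map_eq hσy hy' hx'
    ((σ.map_app y).trans hqy) hyx hyx'
  refine ⟨σ.trans τ, ?_, hτy, fun w hwx hwy hwx' hwy' => ?_⟩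
  · change τ (σ x) = x'
    rw [hσx]
    refine hτ x' ?_ hx'.polar_self
    rw [QuadraticMap.polar_add_right, h', QuadraticMap.polar_comm, hyx, one_add_one]
  · have hw : σ w = w :=
      hσ w (by rw [QuadraticMap.polar_add_right, hwx, hwx', add_zero]) (huw w hwy hwy')
    change τ (σ w) = w
    rw [hw]
    refine hτ w ?_ hwx'
    rw [QuadraticMap.polar_add_right, hwy', add_zero]
    -- As σ fixes w, the pairing of w with σ y equals that of w with y.
    nth_rewrite 1 [← hw]
    rw [hσp, hwy]

end Transvection

/-! ### Extending isometries pair by pair -/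

/-- A generating family of mutually orthogonal pairs of elements of order two, with integral values
of the form and nontrivial pairing inside each pair. -/
structure IsPairBasis {ι P : Type*} [AddCommGroup P] (Q : Form P) (e₁ e₂ : ι → P) : Prop where
  fst_isEvenTwoTorsion : ∀ i, IsEvenTwoTorsion Q (e₁ i)
  snd_isEvenTwoTorsion : ∀ i, IsEvenTwoTorsion Q (e₂ i)
  polar_eq_one : ∀ i, QuadraticMap.polar Q (e₁ i) (e₂ i) = one
  polar_fst_fst : ∀ i j, i ≠ j → QuadraticMap.polar Q (e₁ i) (e₁ j) = 0
  polar_fst_snd : ∀ i j, i ≠ j → QuadraticMap.polar Q (e₁ i) (e₂ j) = 0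
  polar_snd_snd : ∀ i j, i ≠ j → QuadraticMap.polar Q (e₂ i) (e₂ j) = 0
  span_eq_top : Submodule.span ℤ (Set.range e₁ ∪ Set.range e₂) = ⊤

/-- Any two isometric maps from a form with such a family differ by an isometry of the target. -/
theorem IsPairBasis.exists_isometry_comp_eq {ι P A : Type*} [Finite ι] [AddCommGroup P]
    [AddCommGroup A] {Q : Form P} {q : Form A} {e₁ e₂ : ι → P} (he : IsPairBasis Q e₁ e₂)
    (f g : Q →qᵢ q) : ∃ σ : q.IsometryEquiv q, ∀ p, σ (f p) = g p := by
  classical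
  have key : ∀ s : Finset ι, ∃ σ : q.IsometryEquiv q,
      ∀ i ∈ s, σ (f (e₁ i)) = g (e₁ i) ∧ σ (f (e₂ i)) = g (e₂ i) := by
    intro s
    induction s using Finset.induction_on with
    | empty => exact ⟨QuadraticMap.IsometryEquiv.refl q, by simp⟩
    | insert a s ha ih =>
      obtain ⟨σ, hσ⟩ := ih
      let k : Q →qᵢ q := σ.toIsometry.comp f
      obtain ⟨τ, hτ₁, hτ₂, hτ⟩ := exists_isometry_map_pair_eq
        ((he.fst_isEvenTwoTorsion a).map k) ((he.snd_isEvenTwoTorsion a).map k)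
        ((he.fst_isEvenTwoTorsion a).map g) ((he.snd_isEvenTwoTorsion a).map g)
        (by simp) (by simp) ((polar_map k _ _).trans (he.polar_eq_one a))
        ((polar_map g _ _).trans (he.polar_eq_one a))
      refine ⟨σ.trans τ, fun i hi => ?_⟩
      rcases Finset.mem_insert.1 hi with rfl | hi
      · exact ⟨hτ₁, hτ₂⟩
      · have hia : i ≠ a := fun h => ha (h ▸ hi)
        -- If p is already matched and orthogonal to the new pair, its common image is orthogonal to
        -- the images of that pair under both k and g, so τ leaves it alone.
        have fixed : ∀ p, k p = g p → QuadraticMap.polar Q p (e₁ a) = 0 →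
            QuadraticMap.polar Q p (e₂ a) = 0 → τ (k p) = g p := by
          intro p hp h1 h2
          rw [hp]
          refine hτ (g p) ?_ ?_ ((polar_map g _ _).trans h1) ((polar_map g _ _).trans h2)
          · rw [← hp, polar_map, h1]
          · rw [← hp, polar_map, h2]
        exact ⟨fixed _ (hσ i hi).1 (he.polar_fst_fst i a hia) (he.polar_fst_snd i a hia),
          fixed _ (hσ i hi).2
            ((QuadraticMap.polar_comm _ _ _).trans (he.polar_fst_snd a i hia.symm))
            (he.polar_snd_snd i a hia)⟩
  cases nonempty_fintype ι
  obtain ⟨σ, hσ⟩ := key Finset.univ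
  refine ⟨σ, fun p => ?_⟩
  have hlin : (σ.toIsometry.comp f).toLinearMap = g.toLinearMap := by
    refine LinearMap.ext_on he.span_eq_top ?_
    rintro _ (⟨i, rfl⟩ | ⟨i, rfl⟩)
    · exact (hσ i (Finset.mem_univ i)).1
    · exact (hσ i (Finset.mem_univ i)).2
  exact LinearMap.congr_fun hlin p

/-! ### The standard pairs in u(2)^m ⊕ v(2)^n -/

theorem ofZMod2_one : ofZMod2 1 = one := by simpa [one] using ofZMod2_intCast 1

theorem isEvenTwoTorsion_of_ofZMod2 {P : Type*} [AddCommGroup P] {Q : Form P} {r : P}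
    (hr : r + r = 0) {c : ZMod 2} (h : Q r = ofZMod2 c) : IsEvenTwoTorsion Q r := by
  refine ⟨hr, ?_⟩
  rw [h]
  fin_cases c
  · exact Or.inl (map_zero _)
  · exact Or.inr ofZMod2_one

theorem polar_sumUV {m n : ℕ} (a b : (Fin m → ZMod 2 × ZMod 2) × (Fin n → ZMod 2 × ZMod 2)) :
    QuadraticMap.polar (sumUV m n) a b =
      ∑ i, QuadraticMap.polar uTwo (a.1 i) (b.1 i) +
        ∑ i, QuadraticMap.polar vTwo (a.2 i) (b.2 i) := by
  simp only [sumUV, QuadraticMap.polar, QuadraticMap.prod_apply, QuadraticMap.pi_apply,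
    Prod.fst_add, Prod.snd_add, Pi.add_apply, Finset.sum_sub_distrib]
  abel

/-- The element of `u(2)^m ⊕ v(2)^n` with a single nonzero component. -/
def sumUVSingle {m n : ℕ} (c : ZMod 2 × ZMod 2) :
    Fin m ⊕ Fin n → (Fin m → ZMod 2 × ZMod 2) × (Fin n → ZMod 2 × ZMod 2) :=
  Sum.elim (fun i => (Pi.single i c, 0)) (fun j => (0, Pi.single j c))

theorem isEvenTwoTorsion_sumUVSingle {m n : ℕ} (c : ZMod 2 × ZMod 2) (k : Fin m ⊕ Fin n) :
    IsEvenTwoTorsion (sumUV m n) (sumUVSingle c k) := by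
  have hc : c + c = 0 := by revert c; decide
  rcases k with i | j
  · refine isEvenTwoTorsion_of_ofZMod2 (c := c.1 * c.2) ?_ ?_
    · simp [sumUVSingle, ← Pi.single_add, hc]
    · simp only [sumUVSingle, sumUV, QuadraticMap.pi_apply_single, ← uTwo_apply, Sum.elim_inl,
        QuadraticMap.prod_apply, QuadraticMap.map_zero, add_zero]
  · refine isEvenTwoTorsion_of_ofZMod2 (c := c.1 * c.1 + c.1 * c.2 + c.2 * c.2) ?_ ?_
    · simp [sumUVSingle, ← Pi.single_add, hc]
    · simp only [sumUVSingle, sumUV, QuadraticMap.pi_apply_single, ← vTwo_apply, Sum.elim_inr,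
        QuadraticMap.prod_apply, QuadraticMap.map_zero, zero_add]

theorem polar_sumUVSingle_of_ne {m n : ℕ} (c d : ZMod 2 × ZMod 2) {k l : Fin m ⊕ Fin n}
    (h : k ≠ l) : QuadraticMap.polar (sumUV m n) (sumUVSingle c k) (sumUVSingle d l) = 0 := by
  have aux : ∀ {N : ℕ} (R : Form (ZMod 2 × ZMod 2)) (i j : Fin N), i ≠ j →
      ∑ x, QuadraticMap.polar R ((Pi.single i c : Fin N → ZMod 2 × ZMod 2) x)
        ((Pi.single j d : Fin N → ZMod 2 × ZMod 2) x) = 0 := by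
    intro N R i j hij
    refine Finset.sum_eq_zero fun x _ => ?_
    by_cases hx : x = i
    · subst hx
      rw [Pi.single_eq_of_ne hij, QuadraticMap.polar_zero_right]
    · rw [Pi.single_eq_of_ne hx, QuadraticMap.polar_zero_left]
  rw [polar_sumUV]
  rcases k with i | i <;> rcases l with j | j
  · simp [sumUVSingle, aux uTwo i j (fun e => h (congrArg _ e))]
  · simp [sumUVSingle]
  · simp [sumUVSingle]
  · simp [sumUVSingle, aux vTwo i j (fun e => h (congrArg _ e))]

theorem polar_sumUVSingle_self {m n : ℕ} (k : Fin m ⊕ Fin n) :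
    QuadraticMap.polar (sumUV m n) (sumUVSingle (1, 0) k) (sumUVSingle (0, 1) k) = one := by
  have aux : ∀ {N : ℕ} (R : Form (ZMod 2 × ZMod 2)) (i : Fin N),
      ∑ x, QuadraticMap.polar R ((Pi.single i (1, 0) : Fin N → ZMod 2 × ZMod 2) x)
        ((Pi.single i (0, 1) : Fin N → ZMod 2 × ZMod 2) x) =
        QuadraticMap.polar R (1, 0) (0, 1) := by
    intro N R i
    rw [Finset.sum_eq_single i (fun x _ hx => by
      rw [Pi.single_eq_of_ne hx, QuadraticMap.polar_zero_left]) (by simp)]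
    rw [Pi.single_eq_same, Pi.single_eq_same]
  have half : doubling ((1 / 2 : ℚ) : QModZ) = one := by
    rw [doubling_mk, one]
    norm_num
  have hu : QuadraticMap.polar uTwo (1, 0) (0, 1) = one := by
    rw [QuadraticMap.polar, ← doubling_bilin, uTwo_gram.2.2, half]
  have hv : QuadraticMap.polar vTwo (1, 0) (0, 1) = one := by
    rw [QuadraticMap.polar, ← doubling_bilin, vTwo_gram.2.2, half]
  rw [polar_sumUV]
  rcases k with i | i
  · simp [sumUVSingle, aux, hu]
  · simp [sumUVSingle, aux, hv]

theorem span_sumUVSingle (m n : ℕ) :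
    Submodule.span ℤ (Set.range (sumUVSingle (m := m) (n := n) (1, 0)) ∪
      Set.range (sumUVSingle (m := m) (n := n) (0, 1))) = ⊤ := by
  set S := Submodule.span ℤ (Set.range (sumUVSingle (m := m) (n := n) (1, 0)) ∪
      Set.range (sumUVSingle (m := m) (n := n) (0, 1))) with hS
  have h1 : ∀ k, sumUVSingle (1, 0) k ∈ S := fun k => Submodule.subset_span (Or.inl ⟨k, rfl⟩)
  have h2 : ∀ k, sumUVSingle (0, 1) k ∈ S := fun k => Submodule.subset_span (Or.inr ⟨k, rfl⟩)
  have hadd : ∀ (c d : ZMod 2 × ZMod 2) (k : Fin m ⊕ Fin n),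
      sumUVSingle (c + d) k = sumUVSingle c k + sumUVSingle d k := by
    rintro c d (i | i) <;> simp [sumUVSingle, Pi.single_add]
  have hall : ∀ (c : ZMod 2 × ZMod 2) k, sumUVSingle c k ∈ S := by
    intro c k
    have hc : c = 0 ∨ c = (1, 0) ∨ c = (0, 1) ∨ c = (1, 0) + (0, 1) := by
      revert c; decide
    rcases hc with rfl | rfl | rfl | rfl
    · have : sumUVSingle 0 k = 0 := by rcases k with i | i <;> simp [sumUVSingle]
      rw [this]
      exact S.zero_mem
    · exact h1 k
    · exact h2 k
    · rw [hadd]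
      exact S.add_mem (h1 k) (h2 k)
  rw [eq_top_iff]
  rintro ⟨a, b⟩ -
  have hab : (a, b) = ∑ i, sumUVSingle (a i) (Sum.inl i : Fin m ⊕ Fin n) +
      ∑ j, sumUVSingle (b j) (Sum.inr j : Fin m ⊕ Fin n) := by
    ext1
    · simp [sumUVSingle, Prod.fst_sum, Finset.univ_sum_single]
    · simp [sumUVSingle, Prod.snd_sum, Finset.univ_sum_single]
  rw [hab]
  exact S.add_mem (S.sum_mem fun i _ => hall _ _) (S.sum_mem fun j _ => hall _ _)

theorem isPairBasis_sumUV (m n : ℕ) :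
    IsPairBasis (sumUV m n) (sumUVSingle (1, 0)) (sumUVSingle (0, 1)) where
  fst_isEvenTwoTorsion := isEvenTwoTorsion_sumUVSingle _
  snd_isEvenTwoTorsion := isEvenTwoTorsion_sumUVSingle _
  polar_eq_one := polar_sumUVSingle_self
  polar_fst_fst _ _ := polar_sumUVSingle_of_ne _ _
  polar_fst_snd _ _ := polar_sumUVSingle_of_ne _ _
  polar_snd_snd _ _ := polar_sumUVSingle_of_ne _ _
  span_eq_top := span_sumUVSingle m n

/-! ### Orthogonal complements and the conclusion -/

theorem mem_perp_iff {A : Type*} [AddCommGroup A] {q : Form A} {S : Submodule ℤ A} {a : A} :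
    a ∈ perp q S ↔ ∀ s ∈ S, QuadraticMap.polar q s a = 0 := by
  rw [perp, Submodule.mem_orthogonalBilin_iff]
  refine forall₂_congr fun s _ => ?_
  rw [QuadraticMap.polar, ← doubling_bilin, LinearEquiv.map_eq_zero_iff]

/-- An isometry carrying one isometric map to another carries the orthogonal complement of the range
of the first onto that of the second. -/
theorem equivalent_restrict_perp_range {P A : Type*} [AddCommGroup P] [AddCommGroup A]
    {Q : Form P} {q : Form A} {f g : Q →qᵢ q} (σ : q.IsometryEquiv q)
    (hσ : ∀ p, σ (f p) = g p) :
    (q.restrict (perp q (LinearMap.range f.toLinearMap))).Equivalent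
      (q.restrict (perp q (LinearMap.range g.toLinearMap))) := by
  have hmap : (perp q (LinearMap.range f.toLinearMap)).map σ.toLinearEquiv.toLinearMap =
      perp q (LinearMap.range g.toLinearMap) := by
    ext a
    rw [Submodule.mem_map_equiv, mem_perp_iff, mem_perp_iff]
    obtain ⟨c, rfl⟩ := σ.toLinearEquiv.surjective a
    rw [LinearEquiv.symm_apply_apply]
    constructor
    · rintro h _ ⟨p, rfl⟩
      change QuadraticMap.polar q (g p) (σ c) = 0
      rw [← hσ]
      exact (polar_map σ.toIsometry _ _).trans (h _ ⟨p, rfl⟩)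
    · rintro h _ ⟨p, rfl⟩
      have := h _ ⟨p, rfl⟩
      change QuadraticMap.polar q (g p) (σ c) = 0 at this
      rw [← hσ] at this
      exact (polar_map σ.toIsometry _ _).symm.trans this
  exact ⟨⟨σ.toLinearEquiv.ofSubmodules _ _ hmap, fun a => σ.map_app a⟩⟩

end FinQuad

theorem mainTheorem11 {A P : Type*} [AddCommGroup A] [Finite A] [AddCommGroup P]
    (q : FinQuad.Form A) (hq : FinQuad.Nondegenerate q)
    (Q : FinQuad.Form P) (hQ : ∃ m n : ℕ, QuadraticMap.Equivalent Q (FinQuad.sumUV m n))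
    (f g : QuadraticMap.Isometry Q q) (hf : Function.Injective f) (hg : Function.Injective g) :
    QuadraticMap.Equivalent
      (q.restrict (FinQuad.perp q (LinearMap.range f.toLinearMap)))
      (q.restrict (FinQuad.perp q (LinearMap.range g.toLinearMap))) := by
  obtain ⟨m, n, ⟨E⟩⟩ := hQ
  obtain ⟨σ, hσ⟩ := (FinQuad.isPairBasis_sumUV m n).exists_isometry_comp_eq
    (f.comp E.symm.toIsometry) (g.comp E.symm.toIsometry)
  refine FinQuad.equivalent_restrict_perp_range σ fun p => ?_
  have h := hσ (E p)
  change σ (f (E.symm (E p))) = g (E.symm (E p)) at h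
  rwa [show E.symm (E p) = p from E.toLinearEquiv.symm_apply_apply p] at h
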